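/- Let $R$ be an associative unital ring, not necessarily commutative, and let $\kappa$ be an infinite cardinal. By a module we mean a right $R$-module. A module $M$ is *flat* if $M\otimes_R-$ preserves injectivity of homomorphisms of left $R$-modules, and *Mittag-Leffler* if for each family $(Q_i \mid i\in I)$ of left $R$-modules the canonical map $M\otimes_R\prod_{i\in I}Q_i\to\prod_{i\in I}(M\otimes_R Q_i)$ is injective. A module is *$\le\kappa$-presented* if it is isomorphic to $F/G$, where $F$ is a free module of rank $\le\kappa$ and $G$ is a submodule of $F$ generated by at most $\kappa$ elements. A module $M$ is a *$\kappa$-restricted flat Mittag-Leffler module* if it is a transfinite extension of $\le\kappa$-presented flat Mittag-Leffler modules, that is, if there are an ordinal $\sigma$ and an increasing chain $(M_\alpha\mid\alpha\le\sigma)$ of submodules of $M$ such that $M_0=0$, $M_\sigma=M$, $M_\alpha=\bigcup_{\beta<\alpha}M_\beta$ for each limit ordinal $\alpha\le\sigma$, and $M_{\alpha+1}/M_\alpha$ is isomorphic to a $\le\kappa$-presented flat Mittag-Leffler module for each $\alpha<\sigma$. Let $\mathcal{FM}_\kappa$ be the class of all $\kappa$-restricted flat Mittag-Leffler modules. Then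 the class $\mathcal{FM}_\kappa$ is precovering: for each module $M$ there are $C\in\mathcal{FM}_\kappa$ and a homomorphism $f:C\to M$ such that for each $C'\in\mathcal{FM}_\kappa$ and each homomorphism $f':C'\to M$ there is a homomorphism $g:C'\to C$ with $f'=fg$. -/

import Mathlib

open scoped TensorProduct

universe u v w

/-!
Throughout, `R` is an associative unital ring, not necessarily commutative.  A right `R`-module is a
module over the opposite ring `Rᵐᵒᵖ`; a left `R`-module is a module over `R`.  The element `m r` of a
right module is written `MulOpposite.op r • m`.
-/

namespace RightModule

section Tensor

variable (R : Type u) [Ring R]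
variable (M : Type v) [AddCommGroup M] [Module Rᵐᵒᵖ M]
variable (N : Type w) [AddCommGroup N] [Module R N]

/-- The subgroup of `M ⊗[ℤ] N` generated by all `(m r) ⊗ n - m ⊗ (r n)`. -/
def balancedRel : AddSubgroup (M ⊗[ℤ] N) :=
  AddSubgroup.closure {t | ∃ (m : M) (r : R) (n : N),
    t = (MulOpposite.op r • m) ⊗ₜ[ℤ] n - m ⊗ₜ[ℤ] (r • n)}

/-- The tensor product `M ⊗_R N`, an abelian group, of a right `R`-module `M` and a left
`R`-module `N` over a not necessarily commutative ring `R`. -/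
abbrev BalancedTensor : Type (max v w) := (M ⊗[ℤ] N) ⧸ balancedRel R M N

variable {M N}

/-- The pure tensor `m ⊗ n` in `M ⊗_R N`. -/
def btmul (m : M) (n : N) : BalancedTensor R M N :=
  QuotientAddGroup.mk' (balancedRel R M N) (m ⊗ₜ[ℤ] n)

theorem btmul_add_left (m m' : M) (n : N) :
    btmul R (m + m') n = btmul R m n + btmul R m' n := by
  simp only [btmul, TensorProduct.add_tmul, map_add]

theorem btmul_add_right (m : M) (n n' : N) :
    btmul R m (n + n') = btmul R m n + btmul R m n' := by
  simp only [btmul, TensorProduct.tmul_add, map_add]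

theorem btmul_op_smul (m : M) (r : R) (n : N) :
    btmul R (MulOpposite.op r • m) n = btmul R m (r • n) := by
  have h : (MulOpposite.op r • m) ⊗ₜ[ℤ] n - m ⊗ₜ[ℤ] (r • n) ∈ balancedRel R M N :=
    AddSubgroup.subset_closure ⟨m, r, n, rfl⟩
  have h' := (QuotientAddGroup.eq_zero_iff _).2 h
  rw [← sub_eq_zero]
  exact h'

/-- The universal property of `M ⊗_R N`: a biadditive map `f` with `f (m r) n = f m (r n)` induces an
additive map on `M ⊗_R N`. -/
def balancedLift {A : Type*} [AddCommGroup A] (f : M →+ N →+ A)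
    (hf : ∀ (m : M) (r : R) (n : N), f (MulOpposite.op r • m) n = f m (r • n)) :
    BalancedTensor R M N →+ A :=
  QuotientAddGroup.lift (balancedRel R M N)
    (TensorProduct.liftAddHom f (fun z m n => by simp))
    (by
      rw [balancedRel, AddSubgroup.closure_le]
      rintro _ ⟨m, r, n, rfl⟩
      simp [hf])

@[simp]
theorem balancedLift_btmul {A : Type*} [AddCommGroup A] (f : M →+ N →+ A)
    (hf : ∀ (m : M) (r : R) (n : N), f (MulOpposite.op r • m) n = f m (r • n)) (m : M) (n : N) :
    balancedLift R f hf (btmul R m n) = f m n := rfl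

variable (M)

/-- The additive map `M ⊗_R f : M ⊗_R N → M ⊗_R N'`, `m ⊗ n ↦ m ⊗ f n`, for an `R`-linear map
`f : N → N'` of left modules. -/
def balancedLTensor {N' : Type*} [AddCommGroup N'] [Module R N'] (f : N →ₗ[R] N') :
    BalancedTensor R M N →+ BalancedTensor R M N' :=
  balancedLift R
    (AddMonoidHom.mk' (fun m => AddMonoidHom.mk' (fun n => btmul R m (f n))
        (fun n n' => by rw [map_add, btmul_add_right]))
      (fun m m' => by ext n; exact btmul_add_left R m m' (f n)))
    (fun m r n => by simp [btmul_op_smul])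

/-- The canonical map `M ⊗_R ∏ Q i → ∏ (M ⊗_R Q i)`, `m ⊗ q ↦ (m ⊗ q i)_i`. -/
def balancedPiHom {ι : Type*} (Q : ι → Type*) [∀ i, AddCommGroup (Q i)] [∀ i, Module R (Q i)] :
    BalancedTensor R M (∀ i, Q i) →+ ∀ i, BalancedTensor R M (Q i) :=
  balancedLift R
    (AddMonoidHom.mk' (fun m => AddMonoidHom.mk' (fun q i => btmul R m (q i))
        (fun q q' => by ext i; exact btmul_add_right R m (q i) (q' i)))
      (fun m m' => by ext q i; exact btmul_add_left R m m' (q i)))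
    (fun m r q => by ext i; simp [btmul_op_smul])

end Tensor

section Classes

variable (R : Type u) [Ring R]

/-- A right `R`-module `M` is flat if `M ⊗_R -` preserves injectivity of maps of left `R`-modules. -/
def IsFlat (M : Type u) [AddCommGroup M] [Module Rᵐᵒᵖ M] : Prop :=
  ∀ (N N' : Type u) [AddCommGroup N] [AddCommGroup N'] [Module R N] [Module R N']
    (f : N →ₗ[R] N'), Function.Injective f → Function.Injective (balancedLTensor R M f)

/-- A right `R`-module `M` is Mittag-Leffler if for each family `(Q i)` of left `R`-modules the
canonical map `M ⊗_R ∏ Q i → ∏ (M ⊗_R Q i)` is injective. -/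
def IsMittagLeffler (M : Type u) [AddCommGroup M] [Module Rᵐᵒᵖ M] : Prop :=
  ∀ (ι : Type u) (Q : ι → Type u) [∀ i, AddCommGroup (Q i)] [∀ i, Module R (Q i)],
    Function.Injective (balancedPiHom R M Q)

end Classes

section General

variable {S : Type u} [Ring S]

/-- An `S`-module is `≤ κ`-presented if it is isomorphic to `F ⧸ G` with `F` free on a set of
cardinality `≤ κ` and `G` a submodule generated by a set of cardinality `≤ κ`. -/
def IsLEPresented (S : Type u) [Ring S] (κ : Cardinal.{u})
    (M : Type u) [AddCommGroup M] [Module S M] : Prop :=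
  ∃ (ι : Type u) (X : Set (ι →₀ S)), Cardinal.mk ι ≤ κ ∧ Cardinal.mk X ≤ κ ∧
    Nonempty (((ι →₀ S) ⧸ Submodule.span S X) ≃ₗ[S] M)

/-- `(F α | α ≤ σ)` is a filtration of `M` with all consecutive factors isomorphic to modules from the
class `C`.  Values `F α` with `α > σ` are irrelevant. -/
structure IsFiltration (C : CategoryTheory.ObjectProperty (ModuleCat.{u} S))
    (M : Type u) [AddCommGroup M] [Module S M]
    (σ : Ordinal.{u}) (F : Ordinal.{u} → Submodule S M) : Prop where
  mono : ∀ α β, α ≤ β → β ≤ σ → F α ≤ F β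
  zero : F 0 = ⊥
  limit : ∀ α ≤ σ, Order.IsSuccLimit α → (F α : Set M) = ⋃ β, ⋃ (_ : β < α), (F β : Set M)
  top : F σ = ⊤
  factor : ∀ α < σ, ∃ D : ModuleCat.{u} S, C D ∧
    Nonempty ((F (α + 1) ⧸ (F α).submoduleOf (F (α + 1))) ≃ₗ[S] D)

/-- `Filt C` is the class of all transfinite extensions of modules from the class `C`. -/
def Filt (C : CategoryTheory.ObjectProperty (ModuleCat.{u} S)) :
    CategoryTheory.ObjectProperty (ModuleCat.{u} S) :=
  fun M => ∃ (σ : Ordinal.{u}) (F : Ordinal.{u} → Submodule S M), IsFiltration C M σ F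

open CategoryTheory in
/-- `f : D ⟶ M` is a `C`-precover of `M` if `D` is in `C` and every map from a module in `C` to `M`
factors through `f`. -/
def IsPrecover (C : ObjectProperty (ModuleCat.{u} S)) {D M : ModuleCat.{u} S} (f : D ⟶ M) : Prop :=
  C D ∧ ∀ (D' : ModuleCat.{u} S) (f' : D' ⟶ M), C D' → ∃ g : D' ⟶ D, f' = g ≫ f

open CategoryTheory in
/-- A class of modules is precovering if every module has a precover in it. -/
def IsPrecovering (C : ObjectProperty (ModuleCat.{u} S)) : Prop :=
  ∀ M : ModuleCat.{u} S, ∃ (D : ModuleCat.{u} S) (f : D ⟶ M), IsPrecover C f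

end General

/-- The class of all `≤ κ`-presented flat Mittag-Leffler right `R`-modules. -/
def presentedFlatMittagLeffler (R : Type u) [Ring R] (κ : Cardinal.{u}) :
    CategoryTheory.ObjectProperty (ModuleCat.{u} Rᵐᵒᵖ) :=
  fun M => IsLEPresented Rᵐᵒᵖ κ M ∧ IsFlat R M ∧ IsMittagLeffler R M

/-- The class of all `κ`-restricted flat Mittag-Leffler right `R`-modules: the transfinite
extensions of `≤ κ`-presented flat Mittag-Leffler modules. -/
def restrictedFlatMittagLeffler (R : Type u) [Ring R] (κ : Cardinal.{u}) :
    CategoryTheory.ObjectProperty (ModuleCat.{u} Rᵐᵒᵖ) :=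
  Filt (presentedFlatMittagLeffler R κ)

end RightModule

/-! Any class `C` whose members are quotients of one projective module `F` has precovering `Filt C`;
here `F` is free of rank `κ`. A map `f : X → M` with `X` in `Filt C` is a precover once it has the
right lifting property against the inclusions `K → F` with `F ⧸ K` in `C`: a lift is then extended
along a filtration one factor at a time (`IsFiltration.exists_lift`).

Such an `f` comes from a small object argument done in one stroke (`exists_filt_lifting`). A lifting
problem is coded by a cell `(K, g, h)`, where `h k` is a finite combination of earlier cells
representing the image of `k`. All codes form a W-type, well-ordered so that a cell exceeds those it
mentions. Recursion picks out the meaningful codes; the other cells are attached by zero. Gluing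
copies of `F` along the cells gives `X`, filtered by the `F ⧸ K c`. Every lifting problem for `f` is
the code of some cell, whose copy of `F` solves it. That this code is meaningful follows from
`IsAttaching.mem_cellRel_Iio`: gluing later cells creates no new relations among earlier ones. -/

namespace RightModule

/-! ### Relations in a module glued from cells -/

section CellAttachment

variable {S : Type u} [Ring S] {W : Type v} {F : Type w} [AddCommGroup F] [Module S F]

/-- The relations `single c k = h c k`, for `c ∈ s` and `k ∈ K c`, gluing copies of `F` along the
maps `h c : K c → W →₀ F`. -/
noncomputable def cellRel (K : W → Submodule S F) (h : W → F → W →₀ F) (s : Set W) : Submodule S (W →₀ F) :=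
  Submodule.span S {x | ∃ c ∈ s, ∃ k ∈ K c, x = Finsupp.single c k - h c k}

variable (K : W → Submodule S F) (h : W → F → W →₀ F)

variable {K h}

theorem cellRel_mono {s t : Set W} (hst : s ⊆ t) : cellRel K h s ≤ cellRel K h t :=
  Submodule.span_mono fun _ ⟨c, hc, hx⟩ => ⟨c, hst hc, hx⟩

theorem single_sub_mem_cellRel {s : Set W} {c : W} (hc : c ∈ s) {k : F} (hk : k ∈ K c) :
    Finsupp.single c k - h c k ∈ cellRel K h s :=
  Submodule.subset_span ⟨c, hc, k, hk, rfl⟩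

variable [LinearOrder W]

variable (K h) in
/-- Each `h c` takes values in the cells below `c`, and is linear on `K c` modulo the relations of
the cells below `c`. -/
structure IsAttaching : Prop where
  supp : ∀ c, ∀ k ∈ K c, h c k ∈ Finsupp.supported F S (Set.Iio c)
  add : ∀ c, ∀ k ∈ K c, ∀ k' ∈ K c, h c (k + k') - h c k - h c k' ∈ cellRel K h (Set.Iio c)
  smul : ∀ c (s : S), ∀ k ∈ K c, h c (s • k) - s • h c k ∈ cellRel K h (Set.Iio c)

namespace IsAttaching

theorem cellRel_le_supported (H : IsAttaching K h) (c : W) :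
    cellRel K h (Set.Iio c) ≤ Finsupp.supported F S (Set.Iio c) := by
  refine Submodule.span_le.2 ?_
  rintro _ ⟨d, hd, k, hk, rfl⟩
  refine sub_mem (Finsupp.single_mem_supported S k hd) ?_
  exact Finsupp.supported_mono (Set.Iio_subset_Iio (le_of_lt hd)) (H.supp d k hk)

theorem map_zero_mem (H : IsAttaching K h) (c : W) : h c 0 ∈ cellRel K h (Set.Iio c) := by
  simpa using H.smul c 0 0 (zero_mem _)

/-- Since `h c` is linear on `K c` modulo lower relations, any combination of relations of the cell
`c` collapses to a single one. -/
theorem exists_sub_mem (H : IsAttaching K h) {c : W} {x : W →₀ F}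
    (hx : x ∈ cellRel K h (Set.Iic c)) :
    ∃ k ∈ K c, x - (Finsupp.single c k - h c k) ∈ cellRel K h (Set.Iio c) := by
  induction hx using Submodule.span_induction with
  | mem x hx =>
    obtain ⟨d, hd, k, hk, rfl⟩ := hx
    rcases (Set.mem_Iic.1 hd).lt_or_eq with hd | rfl
    · refine ⟨0, zero_mem _, ?_⟩
      rw [Finsupp.single_zero, zero_sub, sub_neg_eq_add]
      exact add_mem (single_sub_mem_cellRel (Set.mem_Iio.2 hd) hk) (H.map_zero_mem c)
    · exact ⟨k, hk, by rw [sub_self]; exact zero_mem _⟩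
  | zero => exact ⟨0, zero_mem _, by simpa using H.map_zero_mem c⟩
  | add x y _ _ hx hy =>
    obtain ⟨k, hk, hx⟩ := hx
    obtain ⟨l, hl, hy⟩ := hy
    refine ⟨k + l, add_mem hk hl, ?_⟩
    convert add_mem (add_mem hx hy) (H.add c k hk l hl) using 1
    rw [Finsupp.single_add]
    abel
  | smul s x _ hx =>
    obtain ⟨k, hk, hx⟩ := hx
    refine ⟨s • k, Submodule.smul_mem _ s hk, ?_⟩
    convert add_mem (Submodule.smul_mem _ s hx) (H.smul c s k hk) using 1
    rw [← Finsupp.smul_single, smul_sub, smul_sub]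
    abel

theorem apply_mem (H : IsAttaching K h) {c : W} {x : W →₀ F}
    (hx : x ∈ cellRel K h (Set.Iic c)) : x c ∈ K c := by
  obtain ⟨k, hk, hx⟩ := H.exists_sub_mem hx
  have h1 := (Finsupp.mem_supported' S _).1 (H.cellRel_le_supported c hx) c (lt_irrefl c)
  have h2 := (Finsupp.mem_supported' S _).1 (H.supp c k hk) c (lt_irrefl c)
  simp only [Finsupp.coe_sub, Pi.sub_apply, Finsupp.single_eq_same, h2, sub_zero] at h1
  rwa [sub_eq_zero.1 h1]

theorem mem_cellRel_Iio_of_apply_eq_zero (H : IsAttaching K h) {c : W} {x : W →₀ F}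
    (hx : x ∈ cellRel K h (Set.Iic c)) (hxc : x c = 0) : x ∈ cellRel K h (Set.Iio c) := by
  obtain ⟨k, hk, hx⟩ := H.exists_sub_mem hx
  have h1 := (Finsupp.mem_supported' S _).1 (H.cellRel_le_supported c hx) c (lt_irrefl c)
  have h2 := (Finsupp.mem_supported' S _).1 (H.supp c k hk) c (lt_irrefl c)
  simp only [Finsupp.coe_sub, Pi.sub_apply, Finsupp.single_eq_same, h2, sub_zero, hxc,
    zero_sub, neg_eq_zero] at h1
  subst h1
  simpa using sub_mem hx (H.map_zero_mem c)

end IsAttaching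

/-- A relation involves finitely many cells, so it has a top one; this starts each descent below. -/
theorem exists_mem_cellRel_Iic {s : Set W} {x : W →₀ F} (hx : x ∈ cellRel K h s) :
    x = 0 ∨ ∃ c ∈ s, x ∈ cellRel K h (Set.Iic c) := by
  induction hx using Submodule.span_induction with
  | mem x hx =>
    obtain ⟨d, hd, k, hk, rfl⟩ := hx
    exact .inr ⟨d, hd, single_sub_mem_cellRel (Set.mem_Iic.2 le_rfl) hk⟩
  | zero => exact .inl rfl
  | add x y _ _ hx hy =>
    rcases hx with rfl | ⟨c, hc, hx⟩
    · simpa using hy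
    rcases hy with rfl | ⟨d, hd, hy⟩
    · exact .inr ⟨c, hc, by simpa using hx⟩
    rcases le_total c d with hcd | hcd
    · exact .inr ⟨d, hd, add_mem (cellRel_mono (Set.Iic_subset_Iic.2 hcd) hx) hy⟩
    · exact .inr ⟨c, hc, add_mem hx (cellRel_mono (Set.Iic_subset_Iic.2 hcd) hy)⟩
  | smul r x _ hx =>
    rcases hx with rfl | ⟨c, hc, hx⟩
    · exact .inl (smul_zero r)
    · exact .inr ⟨c, hc, Submodule.smul_mem _ r hx⟩

namespace IsAttaching

variable [WellFoundedLT W]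

/-- Descent on the top cell `d` used: if `c ≤ d`, the coordinate of `x` at `d` vanishes, so `d` can
be dispensed with. Hence the module glued from the cells below `c` embeds in the whole. -/
theorem mem_cellRel_Iio (H : IsAttaching K h) {c : W} {x : W →₀ F}
    (hx : x ∈ cellRel K h Set.univ) (hxc : x ∈ Finsupp.supported F S (Set.Iio c)) :
    x ∈ cellRel K h (Set.Iio c) := by
  rcases exists_mem_cellRel_Iic hx with rfl | ⟨d, -, hd⟩
  · exact zero_mem _
  induction d using WellFoundedLT.induction with
  | ind d ih =>
    rcases lt_or_ge d c with hdc | hdc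
    · exact cellRel_mono (fun e he => lt_of_le_of_lt he hdc) hd
    have hxd : x d = 0 := (Finsupp.mem_supported' S _).1 hxc d (not_lt.2 hdc)
    rcases exists_mem_cellRel_Iic (H.mem_cellRel_Iio_of_apply_eq_zero hd hxd) with
      rfl | ⟨e, he, hx⟩
    · exact zero_mem _
    · exact ih e he hx

/-- The same descent, stopped at `c`, where the coordinate must lie in `K c`. This makes the
filtration factor at `c` exactly `F ⧸ K c`. -/
theorem mem_of_single_sub_mem (H : IsAttaching K h) {c : W} {z : F} {e : W →₀ F}
    (he : e ∈ Finsupp.supported F S (Set.Iio c))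
    (hz : Finsupp.single c z - e ∈ cellRel K h Set.univ) : z ∈ K c := by
  have hec : e c = 0 := (Finsupp.mem_supported' S _).1 he c (lt_irrefl c)
  have hsc : ∀ d, c < d → (Finsupp.single c z - e) d = 0 := fun d hd => by
    rw [Finsupp.sub_apply, Finsupp.single_eq_of_ne hd.ne',
      (Finsupp.mem_supported' S _).1 he d (not_lt.2 hd.le), sub_zero]
  have hxc : (Finsupp.single c z - e) c = z := by simp [hec]
  rcases exists_mem_cellRel_Iic hz with h0 | ⟨d, -, hd⟩
  · rw [← hxc, h0]
    exact zero_mem _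
  rw [← hxc]
  generalize Finsupp.single c z - e = x at *
  induction d using WellFoundedLT.induction with
  | ind d ih =>
    rcases le_or_gt d c with hdc | hdc
    · exact H.apply_mem (cellRel_mono (Set.Iic_subset_Iic.2 hdc) hd)
    rcases exists_mem_cellRel_Iic (H.mem_cellRel_Iio_of_apply_eq_zero hd (hsc d hdc)) with
      rfl | ⟨e, he, hx⟩
    · exact zero_mem _
    · exact ih e he hx

end IsAttaching

end CellAttachment

/-! ### Filtration of the glued module by ranks of cells -/

section Filtration

variable {S : Type u} [Ring S] {W : Type u} [LinearOrder W] [WellFoundedLT W] {F : Type u}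
  [AddCommGroup F] [Module S F] {K : W → Submodule S F} {h : W → F → W →₀ F}

/-- The module glued from the cells is filtered by the quotients `F ⧸ K c`. -/
theorem IsAttaching.filt (H : IsAttaching K h) (C : CategoryTheory.ObjectProperty (ModuleCat.{u} S))
    (hK : ∀ c, ∃ D : ModuleCat.{u} S, C D ∧ Nonempty ((F ⧸ K c) ≃ₗ[S] D)) :
    Filt C (ModuleCat.of S ((W →₀ F) ⧸ cellRel K h Set.univ)) := by
  let ρ : W → Ordinal.{u} := Ordinal.typein (α := W) (· < ·)
  have hρ : ∀ {c d}, ρ c < ρ d ↔ c < d := Ordinal.typein_lt_typein (α := W) (· < ·)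
  let q := (cellRel K h Set.univ).mkQ
  let G : Ordinal.{u} → Submodule S (W →₀ F) := fun α => Finsupp.supported F S {c | ρ c < α}
  have hG : ∀ {α β}, α ≤ β → G α ≤ G β := fun hab =>
    Finsupp.supported_mono fun c (hc : ρ c < _) => lt_of_lt_of_le hc hab
  refine ⟨Ordinal.type (α := W) (· < ·), fun α => (G α).map q, ?_, ?_, ?_, ?_, ?_⟩
  · exact fun α β hab _ => Submodule.map_mono (hG hab)
  · have : G 0 = ⊥ := by
      have h0 : {c | ρ c < 0} = ∅ := by ext; simp
      simp only [G, h0, Finsupp.supported_empty]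
    simp only [this, Submodule.map_bot]
  · intro α _ hα
    apply Set.Subset.antisymm
    · rintro _ ⟨e, he, rfl⟩
      -- The support is finite, so its ranks are bounded strictly below the limit `α`.
      have hlt : e.support.sup (fun c => Order.succ (ρ c)) < α :=
        (Finset.sup_lt_iff hα.bot_lt).2 fun c hc => hα.succ_lt (he hc)
      refine Set.mem_iUnion₂.2 ⟨_, hlt, e, ?_, rfl⟩
      intro c hc
      exact lt_of_lt_of_le (Order.lt_succ _)
        (Finset.le_sup (f := fun c => Order.succ (ρ c)) hc)
    · exact Set.iUnion₂_subset fun β hβ => Submodule.map_mono (hG hβ.le)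
  · have : G (Ordinal.type (α := W) (· < ·)) = ⊤ := by
      have h0 : {c | ρ c < Ordinal.type (α := W) (· < ·)} = Set.univ :=
        Set.eq_univ_of_forall fun c => Ordinal.typein_lt_type _ c
      simp only [G, h0, Finsupp.supported_univ]
    simp only [this, Submodule.map_top]
    exact Submodule.range_mkQ _
  · intro α hα
    obtain ⟨c, rfl⟩ := Ordinal.typein_surj (α := W) (· < ·) hα
    change ∃ D : ModuleCat.{u} S, C D ∧ Nonempty
      (((G (ρ c + 1)).map q ⧸ ((G (ρ c)).map q).submoduleOf ((G (ρ c + 1)).map q)) ≃ₗ[S] D)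
    obtain ⟨D, hD, ⟨φ⟩⟩ := hK c
    refine ⟨D, hD, ⟨?_⟩⟩
    have hGc : G (ρ c) = Finsupp.supported F S (Set.Iio c) := by
      exact congrArg (Finsupp.supported F S) (Set.ext fun d => hρ)
    have hs : ∀ z, q (Finsupp.single c z) ∈ (G (ρ c + 1)).map q := fun z =>
      ⟨_, Finsupp.single_mem_supported S z (Order.lt_succ (ρ c)), rfl⟩
    let θ : F →ₗ[S] (G (ρ c + 1)).map q := (q ∘ₗ Finsupp.lsingle c).codRestrict _ hs
    let N := ((G (ρ c)).map q).submoduleOf ((G (ρ c + 1)).map q)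
    have hker : LinearMap.ker (N.mkQ ∘ₗ θ) = K c := by
      ext z
      rw [LinearMap.mem_ker, LinearMap.comp_apply, Submodule.mkQ_apply,
        Submodule.Quotient.mk_eq_zero]
      change q (Finsupp.single c z) ∈ (G (ρ c)).map q ↔ z ∈ K c
      rw [hGc]
      constructor
      · rintro ⟨e, he, heq⟩
        exact H.mem_of_single_sub_mem he ((Submodule.Quotient.eq _).1 heq.symm)
      · exact fun hz => ⟨h c z, H.supp c z hz,
          ((Submodule.Quotient.eq _).2 (single_sub_mem_cellRel (Set.mem_univ c) hz)).symm⟩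
    have hsurj : Function.Surjective (N.mkQ ∘ₗ θ) := by
      intro y
      obtain ⟨⟨_, e, he, rfl⟩, rfl⟩ := Submodule.mkQ_surjective N y
      refine ⟨e c, ?_⟩
      refine (Submodule.Quotient.eq _).2 ?_
      change q (Finsupp.single c (e c)) - q e ∈ (G (ρ c)).map q
      refine ⟨Finsupp.single c (e c) - e, ?_, map_sub _ _ _⟩
      rw [hGc]
      refine (Finsupp.mem_supported' S _).2 fun d hd => ?_
      rcases (not_lt.1 hd).lt_or_eq with hd | rfl
      · rw [Finsupp.sub_apply, Finsupp.single_eq_of_ne hd.ne', zero_sub, neg_eq_zero]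
        refine (Finsupp.mem_supported' S _).1 he d fun hd' => ?_
        exact absurd (Order.lt_succ_iff.1 hd') (not_le.2 (hρ.2 hd))
      · simp
    exact ((N.mkQ ∘ₗ θ).quotKerEquivOfSurjective hsurj).symm ≪≫ₗ
      Submodule.quotEquivOfEq _ _ hker ≪≫ₗ φ

end Filtration

/-! ### Lifting along filtrations -/

section Lifting

variable {S : Type u} [Ring S]

/-- A partial linear map `p` extends to `p.domain ⊔ range q` by `y` along `q` if `y` agrees with `p`
wherever `q` takes values in `p.domain`. -/
theorem _root_.LinearPMap.exists_extension {N X F : Type*} [AddCommGroup N] [AddCommGroup X]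
    [AddCommGroup F] [Module S N] [Module S X] [Module S F] (p : N →ₗ.[S] X) (q : F →ₗ[S] N)
    (y : F →ₗ[S] X) (hy : ∀ (z : F) (hz : q z ∈ p.domain), p ⟨q z, hz⟩ = y z) :
    ∃ r : N →ₗ.[S] X, p ≤ r ∧ r.domain = p.domain ⊔ LinearMap.range q ∧
      ∀ (z : F) (hz : q z ∈ r.domain), r ⟨q z, hz⟩ = y z := by
  have hker : LinearMap.ker q ≤ LinearMap.ker y := fun z hz => by
    have hz' : q z ∈ p.domain := by rw [LinearMap.mem_ker.1 hz]; exact zero_mem _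
    rw [LinearMap.mem_ker, ← hy z hz', ← p.map_zero]
    congr 1
    exact Subtype.ext hz
  let t : N →ₗ.[S] X :=
    ⟨LinearMap.range q, (LinearMap.ker q).liftQ y hker ∘ₗ q.quotKerEquivRange.symm.toLinearMap⟩
  have ht : ∀ z (hz : q z ∈ t.domain), t ⟨q z, hz⟩ = y z := fun z hz => by
    change (LinearMap.ker q).liftQ y hker (q.quotKerEquivRange.symm ⟨q z, hz⟩) = y z
    have : q.quotKerEquivRange.symm ⟨q z, hz⟩ = (LinearMap.ker q).mkQ z := by
      rw [LinearEquiv.symm_apply_eq]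
      rfl
    rw [this]
    rfl
  have hpt : ∀ (x : p.domain) (z : t.domain), (x : N) = z → p x = t z := by
    rintro ⟨x, hx⟩ ⟨_, z, rfl⟩ hxz
    obtain rfl : x = q z := hxz
    exact (hy z hx).trans (ht z _).symm
  refine ⟨p.sup t hpt, p.left_le_sup t hpt, rfl, fun z hz => ?_⟩
  have hz' : q z ∈ t.domain := ⟨z, rfl⟩
  rw [← ht z hz']
  exact ((p.right_le_sup t hpt).2 (x := ⟨q z, hz'⟩) (y := ⟨q z, hz⟩) rfl).symm

/-- A map having the right lifting property against the inclusions `K → F` with `F ⧸ K` in `C` has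
the lifting property against all `C`-filtered modules. -/
theorem IsFiltration.exists_lift {C : CategoryTheory.ObjectProperty (ModuleCat.{u} S)}
    {F : Type u} [AddCommGroup F] [Module S F] [Module.Projective S F]
    (hC : ∀ D : ModuleCat.{u} S, C D → ∃ π : F →ₗ[S] D, Function.Surjective π)
    {X M : Type*} [AddCommGroup X] [Module S X] [AddCommGroup M] [Module S M] (f : X →ₗ[S] M)
    (hf : ∀ K : Submodule S F, (∃ D : ModuleCat.{u} S, C D ∧ Nonempty ((F ⧸ K) ≃ₗ[S] D)) →
      ∀ (g : F →ₗ[S] M) (φ : K →ₗ[S] X), (∀ k, f (φ k) = g k) →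
        ∃ ψ : F →ₗ[S] X, (∀ k : K, ψ k = φ k) ∧ f ∘ₗ ψ = g)
    {N : Type u} [AddCommGroup N] [Module S N] {σ : Ordinal.{u}} {G : Ordinal.{u} → Submodule S N}
    (hG : IsFiltration C N σ G) (f' : N →ₗ[S] M) : ∃ g : N →ₗ[S] X, f ∘ₗ g = f' := by
  -- Zorn's lemma is applied to partial lifts of `f'` defined on members of the filtration.
  let P : Set (N →ₗ.[S] X) :=
    {p | (∃ α ≤ σ, p.domain = G α) ∧ ∀ x : p.domain, f (p x) = f' x}
  have hP : ∀ c ⊆ P, IsChain (· ≤ ·) c → ∀ p ∈ c, ∃ ub ∈ P, ∀ z ∈ c, z ≤ ub := by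
    intro c hcP hc p₀ hp₀
    have hdir := hc.directedOn
    refine ⟨LinearPMap.sSup c hdir, ⟨?_, ?_⟩, fun z hz => LinearPMap.le_sSup hdir hz⟩
    · let A : Set Ordinal.{u} := {α | α ≤ σ ∧ ∃ p ∈ c, p.domain = G α}
      have hA : A.Nonempty := by
        obtain ⟨⟨α, hα, hpα⟩, -⟩ := hcP hp₀
        exact ⟨α, hα, p₀, hp₀, hpα⟩
      have hlub : IsLUB A (sSup A) := isLUB_csSup hA ⟨σ, fun α hα => hα.1⟩
      have hσ : sSup A ≤ σ := hlub.2 fun α hα => hα.1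
      refine ⟨sSup A, hσ, SetLike.ext fun x => ?_⟩
      rw [LinearPMap.mem_domain_sSup_iff ⟨p₀, hp₀⟩ hdir]
      constructor
      · rintro ⟨p, hp, hx⟩
        obtain ⟨⟨α, hα, hpα⟩, -⟩ := hcP hp
        exact hG.mono _ _ (hlub.1 ⟨hα, p, hp, hpα⟩) hσ (hpα ▸ hx)
      · intro hx
        -- A supremum that is not attained is a limit ordinal, where the filtration is continuous.
        by_cases hmem : sSup A ∈ A
        · obtain ⟨-, p, hp, hpα⟩ := hmem
          exact ⟨p, hp, hpα ▸ hx⟩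
        · have hx' : x ∈ (G (sSup A) : Set N) := hx
          rw [hG.limit _ hσ (hlub.isSuccLimit_of_notMem hA hmem)] at hx'
          obtain ⟨β, hβ, hxβ⟩ := Set.mem_iUnion₂.1 hx'
          obtain ⟨α, ⟨hα, p, hp, hpα⟩, hβα⟩ := (lt_isLUB_iff hlub).1 hβ
          exact ⟨p, hp, hpα ▸ hG.mono _ _ hβα.le hα hxβ⟩
    · rintro ⟨x, hx⟩
      obtain ⟨p, hp, hxp⟩ := (LinearPMap.mem_domain_sSup_iff ⟨p₀, hp₀⟩ hdir).1 hx
      rw [← (hcP hp).2 ⟨x, hxp⟩]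
      exact congrArg f (LinearPMap.sSup_apply hdir hp ⟨x, hxp⟩)
  have hbot : (⊥ : N →ₗ.[S] X) ∈ P := by
    refine ⟨⟨0, zero_le, hG.zero.symm⟩, ?_⟩
    rintro ⟨x, hx⟩
    obtain rfl := (Submodule.mem_bot S).1 hx
    change f 0 = f' 0
    simp
  obtain ⟨p, -, hp⟩ := zorn_le_nonempty₀ P hP ⊥ hbot
  have hpf := hp.prop.2
  have hsucc : ∀ α < σ, p.domain = G α → G (α + 1) ≤ p.domain := by
    intro α hα hpα
    obtain ⟨D, hD, ⟨e⟩⟩ := hG.factor α hα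
    obtain ⟨π, hπ⟩ := hC D hD
    let N' := (G α).submoduleOf (G (α + 1))
    -- Projectivity lifts `π` to `q : F → G (α + 1)`, with `q z` in `G α` exactly when `π z = 0`.
    -- Extending over `G (α + 1)` thus becomes extending from `ker π` to `F`.
    obtain ⟨q, hq⟩ := Module.projective_lifting_property N'.mkQ (e.symm.toLinearMap ∘ₗ π)
      (Submodule.mkQ_surjective _)
    have hqN : ∀ z, (q z : N) ∈ G α ↔ z ∈ LinearMap.ker π := fun z => by
      have h1 : N'.mkQ (q z) = e.symm (π z) := LinearMap.congr_fun hq z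
      rw [LinearMap.mem_ker, ← e.symm.map_eq_zero_iff, ← h1, Submodule.mkQ_apply,
        Submodule.Quotient.mk_eq_zero]
      rfl
    let q' : F →ₗ[S] N := (G (α + 1)).subtype ∘ₗ q
    have hq' : ∀ k : LinearMap.ker π, q' k ∈ p.domain := fun k => by
      rw [hpα]
      exact (hqN k).2 k.2
    obtain ⟨ψ, hψ, hfψ⟩ := hf (LinearMap.ker π) ⟨D, hD, ⟨π.quotKerEquivOfSurjective hπ⟩⟩
      (f' ∘ₗ q') (p.toFun ∘ₗ (q' ∘ₗ (LinearMap.ker π).subtype).codRestrict p.domain hq')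
      (fun k => hpf ⟨q' k, hq' k⟩)
    obtain ⟨r, hpr, hrd, hr⟩ := p.exists_extension q' ψ fun z hz => by
      have hz' : z ∈ LinearMap.ker π := (hqN z).1 (hpα ▸ hz)
      exact (hψ ⟨z, hz'⟩).symm
    have hrα : r.domain = G (α + 1) := by
      have hle := hG.mono α (α + 1) (le_self_add) (Order.add_one_le_of_lt hα)
      rw [hrd, hpα]
      apply le_antisymm
      · refine sup_le hle ?_
        rintro _ ⟨z, rfl⟩
        exact (q z).2
      · intro x hx
        obtain ⟨z, hz⟩ := hπ (e (N'.mkQ ⟨x, hx⟩))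
        have h1 : N'.mkQ (⟨x, hx⟩ - q z) = 0 := by
          rw [map_sub, show N'.mkQ (q z) = e.symm (π z) from LinearMap.congr_fun hq z, hz,
            e.symm_apply_apply, sub_self]
        have h2 : (⟨x, hx⟩ - q z : G (α + 1)) ∈ N' := (Submodule.Quotient.mk_eq_zero _).1 h1
        have h3 : x - q z ∈ G α := h2
        have h4 := Submodule.add_mem_sup h3 (LinearMap.mem_range_self q' z)
        rwa [show x - q z + q' z = x from sub_add_cancel _ _] at h4
    have hrP : r ∈ P := by
      refine ⟨⟨α + 1, Order.add_one_le_of_lt hα, hrα⟩, ?_⟩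
      rintro ⟨x, hx⟩
      obtain ⟨a, ha, _, ⟨z, rfl⟩, rfl⟩ := Submodule.mem_sup.1 (hrd ▸ hx)
      have hz : q' z ∈ r.domain := hrα ▸ (q z).2
      have h1 : r ⟨a + q' z, hx⟩ = p ⟨a, ha⟩ + ψ z := by
        rw [← hr z hz, hpr.2 (x := ⟨a, ha⟩) (y := ⟨a, hpr.1 ha⟩) rfl, ← r.map_add]
        rfl
      rw [h1, map_add, hpf]
      simp only [map_add, add_right_inj]
      exact LinearMap.congr_fun hfψ z
    rw [← hrα]
    exact (hp.le_of_ge hrP hpr).1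
  have hle : ∀ α ≤ σ, G α ≤ p.domain := by
    intro α
    induction α using Ordinal.limitRecOn with
    | zero => exact fun _ => hG.zero ▸ bot_le
    | add_one β ih =>
      intro hβ
      have hβ' : β < σ := Order.add_one_le_iff.1 hβ
      obtain ⟨⟨α, hα, hpα⟩, -⟩ := hp.prop
      rcases lt_or_ge β α with hβα | hαβ
      · exact hpα ▸ hG.mono _ _ (Order.add_one_le_of_lt hβα) hα
      · exact hsucc β hβ' (le_antisymm (hpα ▸ hG.mono _ _ hαβ hβ'.le) (ih hβ'.le))
    | limit α hlim ih =>
      intro hα x hx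
      have hx' : x ∈ (G α : Set N) := hx
      rw [hG.limit _ hα hlim] at hx'
      obtain ⟨β, hβ, hxβ⟩ := Set.mem_iUnion₂.1 hx'
      exact ih β hβ (hβ.le.trans hα) hxβ
  have htop : ∀ x, x ∈ p.domain := fun x => hle σ le_rfl (hG.top ▸ Submodule.mem_top)
  refine ⟨p.toFun ∘ₗ LinearMap.id.codRestrict p.domain htop, ?_⟩
  ext x
  exact hpf ⟨x, htop x⟩

end Lifting

/-! ### The universal system of cells and the small object argument -/

section Cells

/-- A predicate on a well-order can be defined by recursion. -/
theorem exists_pred_iff {W : Type*} [LinearOrder W] [WellFoundedLT W] (T : (W → Prop) → W → Prop)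
    (hT : ∀ P Q c, (∀ d < c, (P d ↔ Q d)) → (T P c ↔ T Q c)) : ∃ P, ∀ c, P c ↔ T P c := by
  let φ : ∀ c : W, (∀ d, d < c → Prop) → Prop := fun c ih => T (fun d => ∃ h : d < c, ih d h) c
  refine ⟨WellFounded.fix (wellFounded_lt (α := W)) φ, fun c => ?_⟩
  rw [WellFounded.fix_eq]
  exact hT _ _ _ fun d hd => ⟨fun ⟨_, h⟩ => h, fun h => ⟨hd, h⟩⟩

variable {S : Type u} [Ring S]

/-- The universal system of cells: a well-ordered set `W` whose elements realize each triple of a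
submodule `K ∈ 𝒦`, a map `g : F → M` and a function `h : F → W →₀ F`, the values of the latter lying
below the element. -/
theorem exists_universal_cells {F M : Type u} [AddCommGroup F] [Module S F] [AddCommGroup M]
    [Module S M] (𝒦 : Set (Submodule S F)) :
    ∃ (W : Type u) (_ : LinearOrder W) (_ : WellFoundedLT W) (K : W → Submodule S F)
      (g : W → F →ₗ[S] M) (h : W → F → W →₀ F), (∀ c, K c ∈ 𝒦) ∧
      (∀ c k, h c k ∈ Finsupp.supported F S (Set.Iio c)) ∧
      ∀ K₀ ∈ 𝒦, ∀ g₀ h₀, ∃ c, K c = K₀ ∧ g c = g₀ ∧ h c = h₀ := by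
  -- A label stores the support sizes and coefficients of the values of `h`; the support points are
  -- the branches, so labels do not refer to `W`.
  let A : Type u := 𝒦 × (F →ₗ[S] M) × Σ n : F → ℕ, ∀ k, Fin (n k) → F
  let B : A → Type u := fun a => Σ k : F, Fin (a.2.2.1 k)
  let W := WType B
  let r : W → W → Prop := fun d c => ∃ b, d = c.toSigma.2 b
  have hr : WellFounded r := by
    refine ⟨fun c => ?_⟩
    induction c with
    | mk a f ih => exact ⟨_, by rintro _ ⟨b, rfl⟩; exact ih b⟩
  have : IsWellFounded W r := ⟨hr⟩
  obtain ⟨s, hrs, hs⟩ := IsWellFounded.exists_well_order_ge r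
  letI : LinearOrder W := by
    classical exact linearOrderOfSTO s
  have hlt : ∀ {d c : W}, r d c → d < c := fun hdc => hrs _ _ hdc
  refine ⟨W, inferInstance, ⟨hs.wf⟩, fun c => c.toSigma.1.1, fun c => c.toSigma.1.2.1,
    fun c k => ∑ i, Finsupp.single (c.toSigma.2 ⟨k, i⟩) (c.toSigma.1.2.2.2 k i),
    fun c => c.toSigma.1.1.2, fun c k => ?_, fun K₀ hK₀ g₀ h₀ => ?_⟩
  · exact Submodule.sum_mem _ fun i _ => Finsupp.single_mem_supported S _ (hlt ⟨_, rfl⟩)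
  · let e : ∀ k, Fin (h₀ k).support.card ≃ (h₀ k).support := fun k => (h₀ k).support.equivFin.symm
    refine ⟨WType.mk (⟨⟨K₀, hK₀⟩, g₀, fun k => (h₀ k).support.card, fun k i => h₀ k (e k i)⟩ : A)
      fun b => e b.1 b.2, rfl, rfl, ?_⟩
    funext k
    change ∑ i, Finsupp.single (e k i : W) (h₀ k (e k i)) = h₀ k
    rw [Equiv.sum_comp (e k) fun x => Finsupp.single (x : W) (h₀ k x),
      Finset.sum_coe_sort (h₀ k).support fun x => Finsupp.single x (h₀ k x)]
    exact Finsupp.sum_single (h₀ k)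

/-- The outcome of the small object argument: each module `M` admits a map from a `C`-filtered module
having the right lifting property against the inclusions `K → F` with `F ⧸ K` in `C`. -/
theorem exists_filt_lifting (C : CategoryTheory.ObjectProperty (ModuleCat.{u} S))
    {F M : Type u} [AddCommGroup F] [Module S F] [AddCommGroup M] [Module S M] :
    ∃ (X : ModuleCat.{u} S) (f : X →ₗ[S] M), Filt C X ∧
      ∀ K : Submodule S F, (∃ D : ModuleCat.{u} S, C D ∧ Nonempty ((F ⧸ K) ≃ₗ[S] D)) →
      ∀ (g : F →ₗ[S] M) (φ : K →ₗ[S] X), (∀ k, f (φ k) = g k) →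
        ∃ ψ : F →ₗ[S] X, (∀ k : K, ψ k = φ k) ∧ f ∘ₗ ψ = g := by
  classical
  obtain ⟨W, _, _, K, g, h, hK, hsupp, hex⟩ := exists_universal_cells (M := M)
    {K : Submodule S F | ∃ D : ModuleCat.{u} S, C D ∧ Nonempty ((F ⧸ K) ≃ₗ[S] D)}
  -- Cells failing `P` are attached along zero and sent to zero in `M`, so they still contribute an
  -- allowed factor `F ⧸ K c`.
  let h' : (W → Prop) → W → F → W →₀ F := fun P c k => if P c then h c k else 0
  let f' : (W → Prop) → (W →₀ F) →ₗ[S] M := fun P =>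
    Finsupp.lsum ℕ fun c => if P c then g c else 0
  obtain ⟨P, hP⟩ := exists_pred_iff
    (fun P c => (∀ k ∈ K c, ∀ k' ∈ K c,
      h c (k + k') - h c k - h c k' ∈ cellRel K (h' P) (Set.Iio c)) ∧
      (∀ (s : S), ∀ k ∈ K c, h c (s • k) - s • h c k ∈ cellRel K (h' P) (Set.Iio c)) ∧
      ∀ k ∈ K c, f' P (h c k) = g c k) (by
    intro P Q c hPQ
    have h1 : cellRel K (h' P) (Set.Iio c) = cellRel K (h' Q) (Set.Iio c) := by
      refine congrArg (Submodule.span S) (Set.ext fun x => ?_)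
      refine exists_congr fun d => and_congr_right fun hd => ?_
      simp only [h', hPQ d hd]
    have h2 : ∀ k, f' P (h c k) = f' Q (h c k) := fun k => by
      simp only [f', Finsupp.lsum_apply]
      refine Finsupp.sum_congr fun d hd => ?_
      simp only [hPQ d (hsupp c k hd)]
    simp only [h1, h2])
  have H : IsAttaching K (h' P) := by
    refine ⟨fun c k _ => ?_, fun c k hk k' hk' => ?_, fun c s k hk => ?_⟩
    all_goals
      by_cases hc : P c
      all_goals simp only [h', hc, if_true, if_false, sub_zero, smul_zero, zero_mem]
    · exact hsupp c k
    · exact ((hP c).1 hc).1 k hk k' hk'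
    · exact ((hP c).1 hc).2.1 s k hk
  let Q := cellRel K (h' P) Set.univ
  have hfQ : Q ≤ LinearMap.ker (f' P) := by
    refine Submodule.span_le.2 ?_
    rintro _ ⟨c, -, k, hk, rfl⟩
    rw [SetLike.mem_coe, LinearMap.mem_ker, map_sub]
    by_cases hc : P c
    · simp only [h', hc, if_true, ((hP c).1 hc).2.2 k hk]
      simp [f', hc]
    · simp [f', h', hc]
  refine ⟨ModuleCat.of S ((W →₀ F) ⧸ Q), Q.liftQ (f' P) hfQ, H.filt C hK,
    fun K₀ hK₀ g₀ φ hφ => ?_⟩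
  -- Representatives are chosen pointwise, hence not linearly; this is why `h` is only a function.
  have hφ' : ∀ k : F, ∃ e : W →₀ F, ∀ hk : k ∈ K₀, Q.mkQ e = φ ⟨k, hk⟩ := fun k => by
    by_cases hk : k ∈ K₀
    · obtain ⟨e, he⟩ := Submodule.mkQ_surjective Q (φ ⟨k, hk⟩)
      exact ⟨e, fun _ => he⟩
    · exact ⟨0, fun hk' => absurd hk' hk⟩
  choose h₀ hh₀ using hφ'
  obtain ⟨c, rfl, rfl, rfl⟩ := hex K₀ hK₀ g₀ h₀
  have hmem : ∀ {x : W →₀ F}, x ∈ Finsupp.supported F S (Set.Iio c) → Q.mkQ x = 0 →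
      x ∈ cellRel K (h' P) (Set.Iio c) := fun hx hx0 =>
    H.mem_cellRel_Iio ((Submodule.Quotient.mk_eq_zero _).1 hx0) hx
  -- Linearity of `φ` gives the identities modulo all relations; `hmem` brings them down to those
  -- below `c`.
  have hc : P c := by
    refine (hP c).2 ⟨fun k hk k' hk' => ?_, fun s k hk => ?_, fun k hk => ?_⟩
    · refine hmem (sub_mem (sub_mem (hsupp _ _) (hsupp _ _)) (hsupp _ _)) ?_
      rw [map_sub, map_sub, hh₀ _ hk, hh₀ _ hk', hh₀ _ (add_mem hk hk'), sub_sub, sub_eq_zero,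
        ← map_add]
      rfl
    · refine hmem (sub_mem (hsupp _ _) (Submodule.smul_mem _ s (hsupp _ _))) ?_
      rw [map_sub, map_smul, hh₀ _ hk, hh₀ _ (Submodule.smul_mem _ s hk), sub_eq_zero,
        ← map_smul]
      rfl
    · rw [← hφ ⟨k, hk⟩, ← hh₀ k hk]
      rfl
  refine ⟨Q.mkQ ∘ₗ Finsupp.lsingle c, fun k => ?_, ?_⟩
  · rw [← hh₀ k k.2]
    refine (Submodule.Quotient.eq _).2 ?_
    have := single_sub_mem_cellRel (h := h' P) (Set.mem_univ c) k.2
    simp only [h', hc, if_true] at this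
    exact this
  · ext z
    change f' P (Finsupp.single c z) = g c z
    simp [f', hc]

end Cells

/-! ### Precovers -/

open CategoryTheory in
/-- The transfinite extensions of a class of modules are precovering, provided that all modules of
the class are quotients of one projective module. -/
theorem isPrecovering_filt {S : Type u} [Ring S] (C : ObjectProperty (ModuleCat.{u} S))
    (F : Type u) [AddCommGroup F] [Module S F] [Module.Projective S F]
    (hC : ∀ D : ModuleCat.{u} S, C D → ∃ π : F →ₗ[S] D, Function.Surjective π) :
    IsPrecovering (Filt C) := by
  intro M
  obtain ⟨X, f, hX, hf⟩ := exists_filt_lifting C (F := F) (M := M)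
  refine ⟨X, ModuleCat.ofHom f, hX, fun D' f' ⟨σ, G, hG⟩ => ?_⟩
  obtain ⟨g, hg⟩ := hG.exists_lift hC f hf f'.hom
  refine ⟨ModuleCat.ofHom g, ?_⟩
  ext x
  exact (LinearMap.congr_fun hg x).symm

/-- A `≤ κ`-presented module is a quotient of the free module of rank `κ`. -/
theorem IsLEPresented.exists_surjective {S : Type u} [Ring S] {κ : Cardinal.{u}} {M : Type u}
    [AddCommGroup M] [Module S M] (hM : IsLEPresented S κ M) :
    ∃ π : (κ.out →₀ S) →ₗ[S] M, Function.Surjective π := by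
  obtain ⟨ι, X, hι, -, ⟨e⟩⟩ := hM
  rw [← Cardinal.mk_out κ] at hι
  obtain ⟨i⟩ := Cardinal.le_def _ _ |>.1 hι
  -- Restricting coordinates along `i : ι ↪ κ.out` is onto, being split by `mapDomain`.
  refine ⟨e.toLinearMap ∘ₗ (Submodule.span S X).mkQ ∘ₗ Finsupp.lcomapDomain i i.injective, ?_⟩
  refine e.surjective.comp ((Submodule.mkQ_surjective _).comp fun x => ?_)
  exact ⟨x.mapDomain i, Finsupp.comapDomain_mapDomain _ i.injective x⟩

end RightModule

theorem corollary3p3 (R : Type u) [Ring R] (κ : Cardinal.{u}) (hκ : Cardinal.aleph0 ≤ κ) :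
    RightModule.IsPrecovering (RightModule.restrictedFlatMittagLeffler R κ) := by
  exact RightModule.isPrecovering_filt _ (κ.out →₀ Rᵐᵒᵖ) fun _ hD => hD.1.exists_surjective
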